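/- Let $G$ be a finite group of odd order. For $x\in G$ and an integer $r$, call $x$ \emph{$r$-semi-rational} in $G$ if, for every integer $j$ coprime to the order of $x$, the element $x^j$ is conjugate in $G$ to $x$ or to $x^{r}$. The group $G$ is called \emph{semi-rational} if for every $x\in G$ there is an integer $r_x$ such that $x$ is $r_x$-semi-rational in $G$; it is called \emph{inverse semi-rational} if every $x\in G$ is $(-1)$-semi-rational in $G$; and it is called \emph{quadratic rational} if, for every irreducible complex character $\chi$ of $G$, the field of values $\mathbb{Q}(\chi)=\mathbb{Q}(\chi(g)\mid g\in G)$ satisfies $[\mathbb{Q}(\chi):\mathbb{Q}]\leq 2$. Then the following properties are equivalent. (1) $G$ is semi-rational. (2) $G$ is quadratic rational. (3) $G$ is inverse semi-rational. -/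

import Mathlib

universe u

/-- The element `x` is `r`-semi-rational in `G`: for every integer `j` coprime to the order of `x`,
the element `x ^ j` is conjugate in `G` to `x` or to `x ^ r`. -/
def IsSemirationalElement {G : Type u} [Group G] (r : ℤ) (x : G) : Prop :=
  ∀ j : ℤ, IsCoprime j (orderOf x : ℤ) → IsConj (x ^ j) x ∨ IsConj (x ^ j) (x ^ r)

/-- `G` is semi-rational: every `x` is `r`-semi-rational for some integer `r` depending on `x`. -/
def IsSemirational (G : Type u) [Group G] : Prop :=
  ∀ x : G, ∃ r : ℤ, IsSemirationalElement r x

/-- `G` is `r`-semi-rational: every `x` is `r`-semi-rational, for the same integer `r`. -/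
def IsUniformlySemirational (r : ℤ) (G : Type u) [Group G] : Prop :=
  ∀ x : G, IsSemirationalElement r x

/-- `G` is inverse semi-rational: it is `(-1)`-semi-rational. -/
def IsInverseSemirational (G : Type u) [Group G] : Prop :=
  IsUniformlySemirational (-1) G

/-- `χ` is the character of an irreducible finite-dimensional complex representation of `G`.
Every finite-dimensional complex vector space has an isomorphic copy in the universe of `G`, so the
universe of `V` is no restriction. -/
def IsIrreducibleCharacter {G : Type u} [Group G] (χ : G → ℂ) : Prop :=
  ∃ (V : Type u) (_ : AddCommGroup V) (_ : Module ℂ V) (ρ : Representation ℂ G V),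
    FiniteDimensional ℂ V ∧ ρ.IsIrreducible ∧ ρ.character = χ

/-- The field of values `ℚ(χ) = ℚ(χ(g) | g ∈ G)`, a subfield of `ℂ`. -/
noncomputable def fieldOfValues {G : Type u} (χ : G → ℂ) : IntermediateField ℚ ℂ :=
  IntermediateField.adjoin ℚ (Set.range χ)

/-- `G` is quadratic rational: `ℚ(χ)` has degree at most `2` over `ℚ` for every irreducible complex
character `χ` of `G`. The degree is taken as a cardinal, so it is at most `2` only if the
extension is finite. -/
def IsQuadraticRational (G : Type u) [Group G] : Prop :=
  ∀ χ : G → ℂ, IsIrreducibleCharacter χ → Module.rank ℚ (fieldOfValues χ) ≤ 2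

/-! An automorphism of ℂ raises the |G|-th roots of unity to a power m coprime to |G|, and every
such m occurs; it sends χ(g) to χ(g^m). So the same exponents govern power maps on classes and
embeddings of ℚ(χ), with m = |G| - 1 giving inversion on classes and complex conjugation on
character values.

Inverse semi-rationality says that these power maps send each class to itself or its inverse. By
orthogonality and completeness of the irreducible characters, this amounts to their sending each χ
to χ or its conjugate (`IsInverseSemirational.comp_pow_eq`, `IsInverseSemirational.of_comp_pow_eq`).
Then ℚ(χ) has at most two embeddings, hence degree at most 2. Conversely, for nonreal χ of degree at
most 2, the identity and conjugation exhaust the embeddings.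

Odd order enters twice: since x ≠ 1 is never conjugate to x⁻¹, the exponent r in semi-rationality
can be replaced by -1; and by Burnside's argument (`IsIrreducibleCharacter.eq_of_real`) at most one
irreducible character is real, so power maps fix it. -/

open Module
open scoped MonoidAlgebra

/-! ### Automorphisms of ℂ and roots of unity -/

/-- An embedding into `ℂ` of an algebraic subfield of `ℂ` extends to an automorphism of `ℂ`. -/
theorem exists_ringEquiv_complex_extending (K : IntermediateField ℚ ℂ) [Algebra.IsAlgebraic ℚ K]
    (φ : K →ₐ[ℚ] ℂ) : ∃ σ : ℂ ≃+* ℂ, ∀ x : K, σ x = φ x := by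
  set Q := algebraicClosure ℚ ℂ
  have hKQ : K ≤ Q := fun x hx ↦ by
    have := Algebra.IsAlgebraic.isAlgebraic (R := ℚ) (⟨x, hx⟩ : K)
    exact (mem_algebraicClosure_iff).2 ((isAlgebraic_algebraMap_iff (A := ℂ) (algebraMap K ℂ).injective).2 this)
  let := (IntermediateField.inclusion hKQ).toRingHom.toAlgebra
  have : Algebra.IsAlgebraic ℚ Q := algebraicClosure.isAlgebraic ℚ ℂ
  have : IsScalarTower ℚ K Q := .of_algebraMap_eq fun _ ↦ rfl
  have : Algebra.IsAlgebraic K Q := Algebra.IsAlgebraic.tower_top (K := ℚ) K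
  have : IsAlgClosure ℚ Q := algebraicClosure.isAlgClosure ℚ ℂ
  have : Normal ℚ Q := IsAlgClosure.normal ℚ Q
  obtain ⟨ψ, hψ⟩ := IsAlgClosed.surjective_domRestrict_of_isAlgebraic (E := Q) φ
  set τ : Q ≃ₐ[ℚ] Q := ψ.restrictNormal' Q
  have hτ : ∀ x : Q, (τ x : ℂ) = ψ x := fun x ↦ by
    exact AlgHom.restrictNormal_commutes ψ Q x
  -- ℂ is an algebraic closure of the polynomial ring over `Q` in a transcendence basis; `e` applies
  -- `τ` to coefficients and fixes the variables.
  obtain ⟨ι, v, hv⟩ := exists_isTranscendenceBasis' Q ℂ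
  have := IsAlgClosed.isAlgClosure_of_transcendence_basis v hv
  let e : Algebra.adjoin Q (Set.range v) ≃+* Algebra.adjoin Q (Set.range v) :=
    (hv.1.aevalEquiv.symm.toRingEquiv.trans (MvPolynomial.mapEquiv ι τ.toRingEquiv)).trans
      hv.1.aevalEquiv.toRingEquiv
  have he : ∀ x : Q, e (algebraMap Q _ x) = algebraMap Q _ (τ x) := fun x ↦ by
    simpa [e, MvPolynomial.algebraMap_eq] using hv.1.aevalEquiv.commutes (τ x)
  refine ⟨IsAlgClosure.equivOfEquiv ℂ ℂ e, fun x ↦ ?_⟩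
  have := IsAlgClosure.equivOfEquiv_algebraMap ℂ ℂ e (algebraMap Q _ (algebraMap K Q x))
  rw [he] at this
  exact this.trans ((hτ _).trans (DFunLike.congr_fun hψ x))

/-- A power map with exponent coprime to `n` on the `n`-th roots of unity is induced by an
automorphism of `ℂ`. -/
theorem exists_ringEquiv_complex_pow {n m : ℕ} [NeZero n] (h : m.Coprime n) :
    ∃ σ : ℂ ≃+* ℂ, ∀ z : ℂ, z ^ n = 1 → σ z = z ^ m := by
  have hζ := Complex.isPrimitiveRoot_exp n (NeZero.ne n)
  set ζ := Complex.exp (2 * Real.pi * Complex.I / n)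
  have hint : IsIntegral ℚ ζ := (hζ.isIntegral (NeZero.pos n)).tower_top
  have : Algebra.IsAlgebraic ℚ (IntermediateField.adjoin ℚ {ζ}) :=
    IntermediateField.isAlgebraic_adjoin_simple hint
  have hroot : Polynomial.aeval (ζ ^ m) (minpoly ℚ ζ) = 0 := by
    rw [← Polynomial.cyclotomic_eq_minpoly_rat hζ (NeZero.pos n)]
    simpa [Polynomial.IsRoot, Polynomial.aeval_def, Polynomial.eval₂_eq_eval_map] using
      (hζ.pow_of_coprime m h).isRoot_cyclotomic (NeZero.pos n)
  obtain ⟨σ, hσ⟩ := exists_ringEquiv_complex_extending (IntermediateField.adjoin ℚ {ζ})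
    ((IntermediateField.adjoin.powerBasis hint).lift (ζ ^ m) (by simpa [IntermediateField.minpoly_gen] using hroot))
  have hσζ : σ ζ = ζ ^ m := by
    have h1 := hσ (IntermediateField.AdjoinSimple.gen ℚ ζ)
    rw [IntermediateField.AdjoinSimple.coe_gen] at h1
    have h2 := (IntermediateField.adjoin.powerBasis hint).lift_gen (ζ ^ m)
      (by simpa [IntermediateField.minpoly_gen] using hroot)
    exact h1.trans ((congrArg _ (IntermediateField.adjoin.powerBasis_gen hint).symm).trans h2)
  refine ⟨σ, fun z hz ↦ ?_⟩
  obtain ⟨i, -, rfl⟩ := hζ.eq_pow_of_pow_eq_one hz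
  rw [map_pow, hσζ, ← pow_mul, ← pow_mul, mul_comm]

/-- Every automorphism of `ℂ` acts on the `n`-th roots of unity as a power map with exponent coprime
to `n`. -/
theorem RingEquiv.exists_coprime_pow_of_complex (n : ℕ) [NeZero n] (σ : ℂ ≃+* ℂ) :
    ∃ m : ℕ, m.Coprime n ∧ ∀ z : ℂ, z ^ n = 1 → σ z = z ^ m := by
  have hζ := Complex.isPrimitiveRoot_exp n (NeZero.ne n)
  set ζ := Complex.exp (2 * Real.pi * Complex.I / n)
  obtain ⟨m, -, hm, h⟩ := (hζ.isPrimitiveRoot_iff).1 (hζ.map_of_injective σ.injective)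
  refine ⟨m, hm, fun z hz ↦ ?_⟩
  obtain ⟨i, -, rfl⟩ := hζ.eq_pow_of_pow_eq_one hz
  rw [map_pow, ← h, ← pow_mul, ← pow_mul, mul_comm]

/-- The traces of the powers of an endomorphism of finite order are the power sums of finitely many
roots of unity. -/
theorem LinearMap.exists_trace_pow_eq_sum {V : Type*} [AddCommGroup V] [Module ℂ V]
    [FiniteDimensional ℂ V] (f : V →ₗ[ℂ] V) {n : ℕ} [NeZero n] (hf : f ^ n = 1) :
    ∃ (d : ℕ) (μ : Fin d → ℂ), (∀ i, μ i ^ n = 1) ∧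
      ∀ m : ℕ, LinearMap.trace ℂ V (f ^ m) = ∑ i, μ i ^ m := by
  classical
  have hss : Module.End.IsSemisimple f :=
    Module.End.isSemisimple_of_squarefree_aeval_eq_zero (p := Polynomial.X ^ n - 1)
      (Polynomial.separable_X_pow_sub_C (1 : ℂ) (NeZero.ne _) one_ne_zero).squarefree
      (by simp [hf])
  have hint : DirectSum.IsInternal fun μ : ℂ ↦ Module.End.eigenspace f μ :=
    DirectSum.isInternal_submodule_of_iSupIndep_of_iSup_eq_top
      (Module.End.eigenspaces_iSupIndep f) hss.iSup_eigenspace_eq_top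
  let b₀ := hint.collectedBasis fun μ ↦ finBasis ℂ (Module.End.eigenspace f μ)
  have : Finite (Σ μ : ℂ, Fin (finrank ℂ (Module.End.eigenspace f μ))) :=
    Module.Finite.finite_basis b₀
  obtain ⟨d, ⟨ε⟩⟩ := Finite.exists_equiv_fin (Σ μ : ℂ, Fin (finrank ℂ (Module.End.eigenspace f μ)))
  let b := b₀.reindex ε
  let μ : Fin d → ℂ := fun i ↦ (ε.symm i).1
  have hb : ∀ i, f (b i) = μ i • b i := fun i ↦ by
    have := hint.collectedBasis_mem (fun μ ↦ finBasis ℂ (Module.End.eigenspace f μ)) (ε.symm i)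
    simpa [b, b₀, μ] using Module.End.mem_eigenspace_iff.1 this
  have hbm : ∀ (m : ℕ) i, (f ^ m) (b i) = μ i ^ m • b i := fun m i ↦ by
    induction m with
    | zero => simp
    | succ m ih => rw [pow_succ', Module.End.mul_apply, ih, map_smul, hb, smul_smul, pow_succ]
  refine ⟨d, μ, fun i ↦ ?_, fun m ↦ ?_⟩
  · have h1 := hbm n i
    rw [hf, Module.End.one_apply] at h1
    have h2 : (μ i ^ n - 1) • b i = 0 := by rw [sub_smul, ← h1, one_smul, sub_self]
    exact sub_eq_zero.1 ((smul_eq_zero.1 h2).resolve_right (b.ne_zero i))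
  · rw [LinearMap.trace_eq_matrix_trace ℂ b]
    simp [Matrix.trace, LinearMap.toMatrix_apply, hbm]

/-! ### Galois conjugates of representations -/

/-- The vector space `V` with scalars acting through the inverse of an automorphism `σ` of `ℂ`. -/
def GaloisTwist (_ : ℂ ≃+* ℂ) (V : Type*) : Type _ := V

namespace GaloisTwist

variable (σ : ℂ ≃+* ℂ) {V : Type*} [AddCommGroup V] [Module ℂ V]

instance : AddCommGroup (GaloisTwist σ V) := inferInstanceAs (AddCommGroup V)

instance : Module ℂ (GaloisTwist σ V) := Module.compHom V (σ.symm : ℂ →+* ℂ)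

/-- The identity map from `V` to its twist. -/
def of : V ≃+ GaloisTwist σ V := AddEquiv.refl V

theorem smul_of (c : ℂ) (v : V) : c • of σ v = of σ (σ.symm c • v) := rfl

/-- An endomorphism of `V` as an endomorphism of its twist. -/
def mapEnd : Module.End ℂ V →* Module.End ℂ (GaloisTwist σ V) where
  toFun f :=
    { toFun := fun v ↦ of σ (f ((of σ).symm v))
      map_add' := fun v w ↦ by simp
      map_smul' := fun c v ↦ by
        obtain ⟨v, rfl⟩ := (of σ).surjective v
        simp [smul_of] }
  map_one' := rfl
  map_mul' _ _ := rfl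

theorem mapEnd_of (f : Module.End ℂ V) (v : V) : mapEnd σ f (of σ v) = of σ (f v) := rfl

/-- A basis of `V` as a basis of its twist. -/
noncomputable def basis {ι : Type*} (b : Basis ι ℂ V) : Basis ι ℂ (GaloisTwist σ V) :=
  .ofRepr
    { toFun := fun v ↦ (b.repr ((of σ).symm v)).mapRange σ (map_zero σ)
      invFun := fun c ↦ of σ (b.repr.symm (c.mapRange σ.symm (map_zero σ.symm)))
      left_inv := fun v ↦ by
        obtain ⟨v, rfl⟩ := (of σ).surjective v
        refine congrArg (of σ) (b.repr.symm_apply_eq.2 ?_)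
        ext; simp
      right_inv := fun c ↦ by
        ext; simp
      map_add' := fun v w ↦ by ext; simp
      map_smul' := fun c v ↦ by
        obtain ⟨v, rfl⟩ := (of σ).surjective v
        ext; simp [smul_of] }

theorem basis_repr {ι : Type*} (b : Basis ι ℂ V) (v : V) (i : ι) :
    (basis σ b).repr (of σ v) i = σ (b.repr v i) := rfl

theorem basis_apply {ι : Type*} (b : Basis ι ℂ V) (i : ι) : basis σ b i = of σ (b i) := by
  apply (basis σ b).repr.injective
  ext j
  rw [basis_repr, Basis.repr_self, Basis.repr_self]
  by_cases h : i = j <;> simp [h]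

instance [FiniteDimensional ℂ V] : FiniteDimensional ℂ (GaloisTwist σ V) :=
  (basis σ (finBasis ℂ V)).finiteDimensional_of_finite

/-- In the twisted basis each matrix entry is replaced by its image under `σ`. -/
theorem trace_mapEnd [FiniteDimensional ℂ V] (f : Module.End ℂ V) :
    LinearMap.trace ℂ _ (mapEnd σ f) = σ (LinearMap.trace ℂ V f) := by
  rw [LinearMap.trace_eq_matrix_trace ℂ (basis σ (finBasis ℂ V)),
    LinearMap.trace_eq_matrix_trace ℂ (finBasis ℂ V), Matrix.trace, Matrix.trace, map_sum]
  refine Finset.sum_congr rfl fun i _ ↦ ?_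
  simp only [Matrix.diag_apply, LinearMap.toMatrix_apply, basis_apply, mapEnd_of, basis_repr]

/-- A representation twisted by an automorphism of `ℂ`. -/
def rep {G : Type*} [Monoid G] (ρ : Representation ℂ G V) : Representation ℂ G (GaloisTwist σ V) :=
  (mapEnd σ).comp ρ

/-- Subrepresentations of a representation and of its twist correspond. -/
def subrepresentationEquiv {G : Type*} [Monoid G] (ρ : Representation ℂ G V) :
    Subrepresentation ρ ≃o Subrepresentation (rep σ ρ) where
  toFun S :=
    { toSubmodule :=
        { carrier := {v | (of σ).symm v ∈ S.toSubmodule}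
          add_mem' := fun ha hb ↦ S.toSubmodule.add_mem ha hb
          zero_mem' := S.toSubmodule.zero_mem
          smul_mem' := fun c _ hv ↦ S.toSubmodule.smul_mem (σ.symm c) hv }
      apply_mem_toSubmodule := fun g _ hv ↦ S.apply_mem_toSubmodule g hv }
  invFun S :=
    { toSubmodule :=
        { carrier := {v | of σ v ∈ S.toSubmodule}
          add_mem' := fun ha hb ↦ S.toSubmodule.add_mem ha hb
          zero_mem' := S.toSubmodule.zero_mem
          smul_mem' := fun c v hv ↦ by
            have := S.toSubmodule.smul_mem (σ c) hv
            change of σ (σ.symm (σ c) • v) ∈ S.toSubmodule at this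
            rwa [σ.symm_apply_apply] at this }
      apply_mem_toSubmodule := fun g _ hv ↦ S.apply_mem_toSubmodule g hv }
  left_inv _ := rfl
  right_inv _ := rfl
  map_rel_iff' := Iff.rfl

end GaloisTwist

/-- The composition of an irreducible character with an automorphism of `ℂ` is an irreducible
character. -/
theorem IsIrreducibleCharacter.galois_comp {G : Type u} [Group G] {χ : G → ℂ}
    (hχ : IsIrreducibleCharacter χ) (σ : ℂ ≃+* ℂ) : IsIrreducibleCharacter fun g ↦ σ (χ g) := by
  obtain ⟨V, _, _, ρ, _, hρ, rfl⟩ := hχ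
  exact ⟨GaloisTwist σ V, inferInstance, inferInstance, GaloisTwist.rep σ ρ, inferInstance,
    (GaloisTwist.subrepresentationEquiv σ ρ).isSimpleOrder_iff.1 hρ,
    funext fun g ↦ GaloisTwist.trace_mapEnd σ (ρ g)⟩

theorem IsIrreducibleCharacter.eq_of_isConj {G : Type u} [Group G] {χ : G → ℂ}
    (hχ : IsIrreducibleCharacter χ) {x y : G} (h : IsConj x y) : χ x = χ y := by
  obtain ⟨V, _, _, ρ, _, hρ, rfl⟩ := hχ
  obtain ⟨c, rfl⟩ := isConj_iff.1 h
  exact (ρ.char_conj x c).symm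

/-! ### Character values on powers and first orthogonality -/

section

variable {G : Type u} [Group G] [Finite G] {χ ψ : G → ℂ}

/-- The values of a character on the powers of an element are the power sums of finitely many roots
of unity. -/
theorem IsIrreducibleCharacter.exists_pow_eq_sum (hχ : IsIrreducibleCharacter χ) (g : G) :
    ∃ (d : ℕ) (μ : Fin d → ℂ), (∀ i, μ i ^ Nat.card G = 1) ∧
      ∀ m : ℕ, χ (g ^ m) = ∑ i, μ i ^ m := by
  obtain ⟨V, _, _, ρ, _, hρ, rfl⟩ := hχ
  have : NeZero (Nat.card G) := ⟨Nat.card_pos.ne'⟩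
  obtain ⟨d, μ, h1, h2⟩ := LinearMap.exists_trace_pow_eq_sum (ρ g) (n := Nat.card G)
    (by rw [← map_pow, pow_card_eq_one', map_one])
  exact ⟨d, μ, h1, fun m ↦ by rw [← h2, ← map_pow]; rfl⟩

theorem IsIrreducibleCharacter.isIntegral (hχ : IsIrreducibleCharacter χ) (g : G) :
    IsIntegral ℚ (χ g) := by
  obtain ⟨d, μ, h1, h2⟩ := hχ.exists_pow_eq_sum g
  rw [← pow_one g, h2]
  refine IsIntegral.sum _ fun i _ ↦ ?_
  rw [pow_one]
  exact .of_pow Nat.card_pos (by rw [h1]; exact isIntegral_one)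

/-- An automorphism of `ℂ` acting on roots of unity as the `m`-th power map takes `χ g` to
`χ (g ^ m)`. -/
theorem IsIrreducibleCharacter.galois_apply (hχ : IsIrreducibleCharacter χ) {σ : ℂ ≃+* ℂ} {m : ℕ}
    (hσ : ∀ z : ℂ, z ^ Nat.card G = 1 → σ z = z ^ m) (g : G) : σ (χ g) = χ (g ^ m) := by
  obtain ⟨d, μ, h1, h2⟩ := hχ.exists_pow_eq_sum g
  have h3 := h2 1
  rw [pow_one] at h3
  rw [h3, h2, map_sum]
  exact Finset.sum_congr rfl fun i _ ↦ by rw [pow_one, hσ _ (h1 i)]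

theorem IsIrreducibleCharacter.exists_galois_eq_pow (hχ : IsIrreducibleCharacter χ) {m : ℕ}
    (hm : m.Coprime (Nat.card G)) : ∃ σ : ℂ ≃+* ℂ, ∀ g, σ (χ g) = χ (g ^ m) := by
  have : NeZero (Nat.card G) := ⟨Nat.card_pos.ne'⟩
  obtain ⟨σ, hσ⟩ := exists_ringEquiv_complex_pow hm
  exact ⟨σ, hχ.galois_apply hσ⟩

theorem IsIrreducibleCharacter.comp_pow (hχ : IsIrreducibleCharacter χ) {m : ℕ}
    (hm : m.Coprime (Nat.card G)) : IsIrreducibleCharacter fun g ↦ χ (g ^ m) := by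
  obtain ⟨σ, hσ⟩ := hχ.exists_galois_eq_pow hm
  simpa only [hσ] using hχ.galois_comp σ

/-- This exponent realises inversion as a coprime power map, so χ(g⁻¹) is a Galois conjugate of χ.
-/
theorem coprime_card_sub_one : (Nat.card G - 1).Coprime (Nat.card G) := by
  have := Nat.card_pos (α := G)
  exact (Nat.coprime_self_sub_left this).2 (Nat.coprime_one_left _)

theorem pow_card_sub_one (g : G) : g ^ (Nat.card G - 1) = g⁻¹ := by
  rw [eq_inv_iff_mul_eq_one, ← pow_succ, Nat.sub_add_cancel Nat.card_pos, pow_card_eq_one']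

theorem IsIrreducibleCharacter.comp_inv (hχ : IsIrreducibleCharacter χ) :
    IsIrreducibleCharacter fun g ↦ χ g⁻¹ := by
  simpa only [pow_card_sub_one] using hχ.comp_pow coprime_card_sub_one

open scoped Classical in
/-- The first orthogonality relation. -/
theorem IsIrreducibleCharacter.sum_mul_inv [Fintype G] (hχ : IsIrreducibleCharacter χ)
    (hψ : IsIrreducibleCharacter ψ) :
    ∑ g, χ g * ψ g⁻¹ = if χ = ψ then (Nat.card G : ℂ) else 0 := by
  have h0 : (Nat.card G : ℂ) ≠ 0 := Nat.cast_ne_zero.2 Nat.card_pos.ne'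
  let : Invertible (Nat.card G : ℂ) := invertibleOfNonzero h0
  obtain ⟨V, _, _, ρ, _, hρ, rfl⟩ := hχ
  split_ifs with h
  · subst h
    have := Representation.char_orthonormal ρ ρ
    rw [if_pos ⟨Representation.Equiv.refl ρ⟩, inv_mul_eq_one₀ h0] at this
    exact this.symm
  · obtain ⟨W, _, _, τ, _, hτ, rfl⟩ := hψ
    have := Representation.char_orthonormal ρ τ
    rw [if_neg fun ⟨e⟩ ↦ h (Representation.char_iso e).symm, mul_eq_zero] at this
    exact this.resolve_left (inv_ne_zero h0)

end

/-! ### Completeness of the irreducible characters -/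

section

variable {G : Type u} [Group G] [Fintype G]

/-- The element `∑ f(g⁻¹) g` of the group algebra attached to a class function `f` acts as zero on
an irreducible representation whose character is orthogonal to `f`. -/
theorem Representation.sum_smul_eq_zero_of_isIrreducible {f : G → ℂ}
    (hf : ∀ x y, IsConj x y → f x = f y) {V : Type u} [AddCommGroup V] [Module ℂ V]
    [FiniteDimensional ℂ V] (ρ : Representation ℂ G V) [ρ.IsIrreducible]
    (h : ∑ g, f g⁻¹ * ρ.character g = 0) : ∑ g, f g⁻¹ • ρ g = 0 := by
  -- The operator commutes with `ρ`, so by Schur it is a scalar; its trace vanishes by `h` and V ≠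
  -- 0, so the scalar is 0.
  have hcomm : ∀ g, (∑ x, f x⁻¹ • ρ x) ∘ₗ ρ g = ρ g ∘ₗ ∑ x, f x⁻¹ • ρ x := fun g ↦ by
    change (∑ x, f x⁻¹ • ρ x) * ρ g = ρ g * ∑ x, f x⁻¹ • ρ x
    rw [Finset.sum_mul, Finset.mul_sum]
    refine Fintype.sum_equiv (MulAut.conj g⁻¹).toEquiv _ _ fun x ↦ ?_
    have h1 : f ((MulAut.conj g⁻¹) x)⁻¹ = f x⁻¹ := by
      rw [← map_inv]
      exact (hf _ _ (isConj_iff.2 ⟨g⁻¹, rfl⟩)).symm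
    rw [MulEquiv.toEquiv_eq_coe, MulEquiv.coe_toEquiv, h1, smul_mul_assoc, mul_smul_comm,
      ← map_mul, ← map_mul]
    simp [mul_assoc]
  let T : Representation.IntertwiningMap ρ ρ := ⟨∑ x, f x⁻¹ • ρ x, hcomm⟩
  obtain ⟨c, hc⟩ :=
    (Representation.IsIrreducible.algebraMap_intertwiningMap_bijective_of_isAlgClosed (ρ := ρ)).2 T
  have hT : ∑ x, f x⁻¹ • ρ x = c • (1 : Module.End ℂ V) := by
    have := congrArg (fun S : Representation.IntertwiningMap ρ ρ ↦ S.toLinearMap) hc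
    exact this.symm
  have htr : LinearMap.trace ℂ V (∑ x, f x⁻¹ • ρ x) = 0 := by
    rw [← h, map_sum]
    simp [Representation.character]
  have hV : Nontrivial V := by
    by_contra hV
    rw [not_nontrivial_iff_subsingleton] at hV
    have : (⊥ : Subrepresentation ρ) = ⊤ :=
      Subrepresentation.toSubmodule_injective (Subsingleton.elim _ _)
    exact bot_ne_top this
  rw [hT, map_smul, LinearMap.trace_one, smul_eq_mul, mul_eq_zero] at htr
  rw [hT, htr.resolve_right (Nat.cast_ne_zero.2 finrank_pos.ne'), zero_smul]

/-- A class function orthogonal to every irreducible character vanishes. -/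
theorem eq_zero_of_forall_isIrreducibleCharacter {f : G → ℂ}
    (hf : ∀ x y, IsConj x y → f x = f y)
    (h : ∀ χ : G → ℂ, IsIrreducibleCharacter χ → ∑ g, f g⁻¹ * χ g = 0) : f = 0 := by
  have : NeZero (Nat.card G : ℂ) := ⟨Nat.cast_ne_zero.2 Nat.card_pos.ne'⟩
  -- `z` kills every simple left ideal; by Maschke these span ℂ[G], so z = z * 1 = 0, and its
  -- coefficients are the values of `f`.
  set z : ℂ[G] := ∑ g, MonoidAlgebra.single g (f g⁻¹) with hz
  have hsimple : ∀ S : Submodule ℂ[G] ℂ[G], IsSimpleModule ℂ[G] S → ∀ s ∈ S, z * s = 0 := by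
    intro S hS s hs
    have hfin : FiniteDimensional ℂ S :=
      inferInstanceAs (FiniteDimensional ℂ (S.restrictScalars ℂ))
    set ρ := Representation.ofModule' (k := ℂ) (G := G) S
    have hρ : ∀ (r : ℂ[G]) (s : S), ρ.asAlgebraHom r s = r • s := fun r s ↦
      congrArg (fun F : ℂ[G] →ₐ[ℂ] Module.End ℂ S ↦ F r s)
        ((MonoidAlgebra.lift ℂ (Module.End ℂ S) G).apply_symm_apply (Algebra.lsmul ℂ ℂ S))
    let e : ρ.asModule ≃ₗ[ℂ[G]] S :=
      { ρ.asModuleEquiv.toAddEquiv with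
        map_smul' := fun r s ↦ (ρ.asModuleEquiv_map_smul r s).trans (hρ _ _) }
    have hirr : ρ.IsIrreducible :=
      ρ.irreducible_iff_isSimpleModule_asModule.2 (IsSimpleModule.congr e)
    have h0 := ρ.sum_smul_eq_zero_of_isIrreducible hf
      (h _ ⟨S, inferInstance, inferInstance, ρ, hfin, hirr, rfl⟩)
    have hzρ : ρ.asAlgebraHom z = 0 := by
      rw [hz, map_sum, ← h0]
      simp [Representation.asAlgebraHom_single]
    have h2 := hρ z ⟨s, hs⟩
    rw [hzρ] at h2
    exact congrArg Subtype.val h2.symm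
  have hz0 : z = 0 := by
    have htop := IsSemisimpleModule.sSup_simples_eq_top ℂ[G] ℂ[G]
    have hmem : ∀ s : ℂ[G], z * s = 0 := fun s ↦ by
      have hs : s ∈ sSup {S : Submodule ℂ[G] ℂ[G] | IsSimpleModule ℂ[G] S} := htop ▸ trivial
      rw [sSup_eq_iSup'] at hs
      induction hs using Submodule.iSup_induction' with
      | mem S s hs => exact hsimple S S.2 s hs
      | zero => exact mul_zero z
      | add a b _ _ ha hb => rw [mul_add, ha, hb, add_zero]
    simpa using hmem 1
  funext g
  classical
  have := congrArg (fun w : ℂ[G] ↦ w.coeff g⁻¹) hz0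
  simpa [hz, Finsupp.single_apply] using this

end

/-! ### Coprime powers and semi-rationality -/

/-- A power of `x` with exponent coprime to the order of `x` is a power of `x` with exponent coprime
to the order of the group. -/
theorem exists_coprime_card_pow_eq_zpow {G : Type u} [Group G] [Finite G] {x : G} {j : ℤ}
    (hj : IsCoprime j (orderOf x : ℤ)) : ∃ m : ℕ, m.Coprime (Nat.card G) ∧ x ^ m = x ^ j := by
  have : NeZero (Nat.card G) := ⟨Nat.card_pos.ne'⟩
  obtain ⟨v, hv⟩ := (ZMod.coe_int_isUnit_iff_isCoprime j (orderOf x)).2 hj.symm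
  -- Units modulo the order of `x` lift to units modulo |G|.
  obtain ⟨w, rfl⟩ := ZMod.unitsMap_surjective (orderOf_dvd_natCard x) v
  refine ⟨(w : ZMod (Nat.card G)).val, ZMod.val_coe_unit_coprime w, ?_⟩
  rw [← zpow_natCast, zpow_eq_zpow_iff_modEq, ← ZMod.intCast_eq_intCast_iff, ← hv]
  rw [ZMod.unitsMap_val, Int.cast_natCast, ZMod.natCast_val]

theorem isInverseSemirational_iff {G : Type u} [Group G] [Finite G] :
    IsInverseSemirational G ↔
      ∀ (x : G) (m : ℕ), m.Coprime (Nat.card G) → IsConj (x ^ m) x ∨ IsConj (x ^ m) x⁻¹ := by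
  refine ⟨fun h x m hm ↦ ?_, fun h x j hj ↦ ?_⟩
  · have := h x m (Nat.isCoprime_iff_coprime.2 (hm.coprime_dvd_right (orderOf_dvd_natCard x)))
    rwa [zpow_natCast, zpow_neg_one] at this
  · obtain ⟨m, hm, hxm⟩ := exists_coprime_card_pow_eq_zpow hj
    rw [← hxm, zpow_neg_one]
    exact h x m hm

theorem IsInverseSemirational.isSemirational {G : Type u} [Group G]
    (h : IsInverseSemirational G) : IsSemirational G :=
  fun x ↦ ⟨-1, h x⟩

/-- In a group of odd order, only the identity is conjugate to its inverse. -/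
theorem eq_one_of_isConj_inv {G : Type u} [Group G] (hG : Odd (Nat.card G)) {x : G}
    (h : IsConj x x⁻¹) : x = 1 := by
  obtain ⟨c, hc⟩ := isConj_iff.1 h
  obtain ⟨k, hk⟩ := hG
  -- Squaring is invertible in odd order, so `c` commutes with `x` as soon as `c ^ 2` does.
  have hpow : ∀ y : G, (y ^ 2) ^ (k + 1) = y := fun y ↦ by
    rw [← pow_mul, show 2 * (k + 1) = Nat.card G + 1 by omega, pow_succ, pow_card_eq_one', one_mul]
  have hc2 : Commute (c ^ 2) x := by
    have h1 : c * x = x⁻¹ * c := mul_inv_eq_iff_eq_mul.1 hc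
    have h2 : c * x⁻¹ = x * c := mul_inv_eq_iff_eq_mul.1 (by rw [← conj_inv, hc, inv_inv])
    rw [commute_iff_eq, pow_two, mul_assoc, h1, ← mul_assoc, h2, mul_assoc]
  have hcx : Commute c x := hpow c ▸ hc2.pow_left (k + 1)
  have hx : x = x⁻¹ := by rw [← hc, hcx.eq, mul_inv_cancel_right]
  rw [← hpow x, pow_two]
  nth_rw 2 [hx]
  rw [mul_inv_cancel, one_pow]

theorem IsSemirational.isInverseSemirational {G : Type u} [Group G] (hG : Odd (Nat.card G))
    (h : IsSemirational G) : IsInverseSemirational G := by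
  intro x j hj
  obtain ⟨r, hr⟩ := h x
  by_cases hx : x = 1
  · simp [hx]
  refine (hr j hj).imp_right fun h1 ↦ h1.trans ?_
  -- Taking j = -1 forces x⁻¹ to be conjugate to x ^ r.
  rcases hr (-1) (isCoprime_one_left.neg_left) with h2 | h2
  · rw [zpow_neg_one] at h2
    exact absurd (eq_one_of_isConj_inv hG h2.symm) hx
  · exact h2.symm

/-! ### Character expansions and second orthogonality -/

section

variable {G : Type u} [Group G] [Fintype G]

theorem linearIndependent_irreducibleCharacter :
    LinearIndependent ℂ (Subtype.val : {χ : G → ℂ // IsIrreducibleCharacter χ} → G → ℂ) := by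
  classical
  rw [linearIndependent_iff']
  intro s c hc ψ hψ
  have h1 : ∑ χ ∈ s, c χ * ∑ g, χ.1 g * ψ.1 g⁻¹ = 0 := by
    simp_rw [Finset.mul_sum]
    rw [Finset.sum_comm]
    refine Finset.sum_eq_zero fun g _ ↦ ?_
    simp_rw [← mul_assoc]
    rw [← Finset.sum_mul]
    have := congrFun hc g
    simp only [Finset.sum_apply, Pi.smul_apply, smul_eq_mul, Pi.zero_apply] at this
    rw [this, zero_mul]
  have h2 : ∀ χ ∈ s, χ ≠ ψ → c χ * ∑ g, χ.1 g * ψ.1 g⁻¹ = 0 := fun χ _ hne ↦ by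
    rw [χ.2.sum_mul_inv ψ.2, if_neg fun h ↦ hne (Subtype.ext h), mul_zero]
  rw [Finset.sum_eq_single_of_mem ψ hψ h2, ψ.2.sum_mul_inv ψ.2, if_pos rfl] at h1
  exact (mul_eq_zero.1 h1).resolve_right (Nat.cast_ne_zero.2 Nat.card_pos.ne')

instance : Finite {χ : G → ℂ // IsIrreducibleCharacter χ} :=
  linearIndependent_irreducibleCharacter.finite

variable [Fintype {χ : G → ℂ // IsIrreducibleCharacter χ}]

/-- The expansion of a class function in irreducible characters. -/
theorem card_mul_eq_sum_irreducibleCharacter {f : G → ℂ} (hf : ∀ x y, IsConj x y → f x = f y)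
    (x : G) : (Nat.card G : ℂ) * f x =
      ∑ χ : {χ : G → ℂ // IsIrreducibleCharacter χ}, (∑ g, f g * χ.1 g⁻¹) * χ.1 x := by
  classical
  -- The defect of the expansion is a class function orthogonal to every irreducible character.
  let F : G → ℂ := fun x ↦ (Nat.card G : ℂ) * f x -
    ∑ χ : {χ : G → ℂ // IsIrreducibleCharacter χ}, (∑ g, f g * χ.1 g⁻¹) * χ.1 x
  suffices h : F = 0 from sub_eq_zero.1 (congrFun h x)
  refine eq_zero_of_forall_isIrreducibleCharacter (fun x y hxy ↦ ?_) fun ψ hψ ↦ ?_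
  · have : ∀ χ : {χ : G → ℂ // IsIrreducibleCharacter χ}, χ.1 x = χ.1 y :=
      fun χ ↦ χ.2.eq_of_isConj hxy
    simp only [F, hf x y hxy, this]
  · rw [← Equiv.sum_comp (Equiv.inv G)]
    simp only [F, Equiv.inv_apply, inv_inv, sub_mul, Finset.sum_sub_distrib, Finset.sum_mul]
    rw [Finset.sum_comm]
    have h1 : ∀ χ : {χ : G → ℂ // IsIrreducibleCharacter χ},
        ∑ x, (∑ g, f g * χ.1 g⁻¹ * χ.1 x * ψ x⁻¹) =
          if χ = ⟨ψ, hψ⟩ then ∑ x, (Nat.card G : ℂ) * f x * ψ x⁻¹ else 0 := fun χ ↦ by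
      simp_rw [mul_assoc _ (χ.1 _) (ψ _), ← Finset.sum_mul]
      rw [← Finset.mul_sum, χ.2.sum_mul_inv hψ]
      by_cases h : χ.1 = ψ
      · rw [if_pos h, if_pos (Subtype.ext h), h, Finset.sum_mul]
        exact Finset.sum_congr rfl fun _ _ ↦ by ring
      · rw [if_neg h, if_neg fun h' ↦ h (congrArg Subtype.val h'), mul_zero]
    rw [Finset.sum_congr rfl fun χ _ ↦ h1 χ, Finset.sum_ite_eq' Finset.univ,
      if_pos (Finset.mem_univ _), sub_self]

/-- The second orthogonality relation. -/
theorem sum_irreducibleCharacter_mul_inv_eq_zero {x y : G} (h : ¬ IsConj x y) :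
    ∑ χ : {χ : G → ℂ // IsIrreducibleCharacter χ}, χ.1 x * χ.1 y⁻¹ = 0 := by
  classical
  -- Expanding the indicator of the class of `y` gives the column relation up to the nonzero class
  -- size.
  let f : G → ℂ := fun g ↦ if IsConj g y then 1 else 0
  have hf : ∀ a b, IsConj a b → f a = f b := fun a b hab ↦ by
    have : IsConj a y ↔ IsConj b y := ⟨hab.symm.trans, hab.trans⟩
    simp only [f, this]
  have h1 := card_mul_eq_sum_irreducibleCharacter hf x
  have h2 : ∀ χ : {χ : G → ℂ // IsIrreducibleCharacter χ},
      (∑ g, f g * χ.1 g⁻¹) * χ.1 x = (∑ g, f g) * (χ.1 x * χ.1 y⁻¹) := fun χ ↦ by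
    rw [mul_comm (χ.1 x), ← mul_assoc]
    refine congrArg (· * χ.1 x) ?_
    rw [Finset.sum_mul]
    refine Finset.sum_congr rfl fun g _ ↦ ?_
    by_cases hg : IsConj g y
    · exact congrArg (f g * ·) (χ.2.comp_inv.eq_of_isConj hg)
    · rw [show f g = 0 from if_neg hg, zero_mul, zero_mul]
  rw [Finset.sum_congr rfl fun χ _ ↦ h2 χ, ← Finset.mul_sum] at h1
  have h3 : f x = 0 := if_neg h
  rw [h3, mul_zero, eq_comm, mul_eq_zero] at h1
  refine h1.resolve_left ?_
  simp only [f, Finset.sum_boole]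
  exact Nat.cast_ne_zero.2 (Finset.card_ne_zero.2 ⟨y, Finset.mem_filter.2 ⟨Finset.mem_univ y, .refl y⟩⟩)

theorem sum_irreducibleCharacter_one_sq :
    ∑ χ : {χ : G → ℂ // IsIrreducibleCharacter χ}, χ.1 1 * χ.1 1 = Nat.card G := by
  classical
  let f : G → ℂ := fun g ↦ if g = 1 then 1 else 0
  have hf : ∀ a b, IsConj a b → f a = f b := fun a b hab ↦ by
    obtain ⟨c, rfl⟩ := isConj_iff.1 hab
    simp [f]
  have h1 := card_mul_eq_sum_irreducibleCharacter hf 1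
  simpa [f] using h1.symm

end

/-! ### Real characters in odd order -/

/-- A group of odd order has only one real irreducible character. -/
theorem IsIrreducibleCharacter.eq_of_real {G : Type u} [Group G] [Finite G]
    (hG : Odd (Nat.card G)) {χ ψ : G → ℂ} (hχ : IsIrreducibleCharacter χ)
    (hψ : IsIrreducibleCharacter ψ) (hχr : ∀ g, χ g⁻¹ = χ g) (hψr : ∀ g, ψ g⁻¹ = ψ g) :
    χ = ψ := by
  classical
  have := Fintype.ofFinite G
  have := Fintype.ofFinite {χ : G → ℂ // IsIrreducibleCharacter χ}
  -- Sum χ(g)² over all g and χ in both orders: by columns only g = 1 contributes, giving |G|; by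
  -- rows each real χ contributes |G|.
  have h1 : ∑ g, ∑ χ : {χ : G → ℂ // IsIrreducibleCharacter χ}, χ.1 g * χ.1 g = Nat.card G := by
    rw [Finset.sum_eq_single 1, sum_irreducibleCharacter_one_sq]
    · intro g _ hg
      simpa using sum_irreducibleCharacter_mul_inv_eq_zero (x := g) (y := g⁻¹)
        fun h ↦ hg (eq_one_of_isConj_inv hG h)
    · simp
  have h2 : ∀ χ : {χ : G → ℂ // IsIrreducibleCharacter χ}, ∑ g, χ.1 g * χ.1 g =
      if χ.1 = fun g ↦ χ.1 g⁻¹ then (Nat.card G : ℂ) else 0 := fun χ ↦ by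
    simpa using χ.2.sum_mul_inv χ.2.comp_inv
  have h0 : (Nat.card G : ℂ) ≠ 0 := Nat.cast_ne_zero.2 Nat.card_pos.ne'
  rw [Finset.sum_comm, Finset.sum_congr rfl fun χ _ ↦ h2 χ, ← Finset.sum_filter,
    Finset.sum_const, nsmul_eq_mul, mul_eq_right₀ h0, Nat.cast_eq_one] at h1
  have h3 := (Finset.card_le_one.1 h1.le) ⟨χ, hχ⟩
    (Finset.mem_filter.2 ⟨Finset.mem_univ _, funext fun g ↦ (hχr g).symm⟩) ⟨ψ, hψ⟩
    (Finset.mem_filter.2 ⟨Finset.mem_univ _, funext fun g ↦ (hψr g).symm⟩)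
  exact congrArg Subtype.val h3

/-! ### Power maps on characters and fields of values -/

section

variable {G : Type u} [Group G] [Finite G]

/-- In an inverse semi-rational group, the power maps act on an irreducible character trivially or
as inversion. -/
theorem IsInverseSemirational.comp_pow_eq (h : IsInverseSemirational G) {χ : G → ℂ}
    (hχ : IsIrreducibleCharacter χ) {m : ℕ} (hm : m.Coprime (Nat.card G)) :
    (fun g ↦ χ (g ^ m)) = χ ∨ (fun g ↦ χ (g ^ m)) = fun g ↦ χ g⁻¹ := by
  classical
  have := Fintype.ofFinite G
  by_contra! hne
  -- With ψ(g) = χ(g^m), this says that ψ and its conjugate have the same sum as χ and its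
  -- conjugate. Pairing with ψ gives |G| or 2|G| on the left and 0 on the right.
  have hsum : ∀ g, χ (g ^ m) + χ (g⁻¹ ^ m) = χ g + χ g⁻¹ := fun g ↦ by
    rw [inv_pow]
    rcases isInverseSemirational_iff.1 h g m hm with h1 | h1
    · rw [hχ.eq_of_isConj h1, hχ.comp_inv.eq_of_isConj h1]
    · rw [hχ.eq_of_isConj h1, hχ.comp_inv.eq_of_isConj h1, inv_inv, add_comm]
  have hψ := hχ.comp_pow hm
  have h1 := hψ.sum_mul_inv hψ
  have h2 := hψ.comp_inv.sum_mul_inv hψ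
  have h3 := hχ.sum_mul_inv hψ
  have h4 := hχ.comp_inv.sum_mul_inv hψ
  rw [if_neg hne.1.symm] at h3
  rw [if_neg hne.2.symm] at h4
  rw [if_pos rfl] at h1
  have h5 := congrArg₂ (· + ·) h1 h2
  simp only [← Finset.sum_add_distrib, ← add_mul, hsum] at h5
  simp only [add_mul, Finset.sum_add_distrib, h3, h4] at h5
  have h0 : (Nat.card G : ℂ) ≠ 0 := Nat.cast_ne_zero.2 Nat.card_pos.ne'
  split_ifs at h5
  · rw [add_zero, eq_comm, add_self_eq_zero] at h5
    exact h0 h5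
  · rw [add_zero, add_zero] at h5
    exact h0 h5.symm

/-- If the power maps act on every irreducible character trivially or as inversion, then the group
is inverse semi-rational. -/
theorem IsInverseSemirational.of_comp_pow_eq
    (h : ∀ χ : G → ℂ, IsIrreducibleCharacter χ → ∀ m : ℕ, m.Coprime (Nat.card G) →
      (fun g ↦ χ (g ^ m)) = χ ∨ (fun g ↦ χ (g ^ m)) = fun g ↦ χ g⁻¹) :
    IsInverseSemirational G := by
  classical
  have := Fintype.ofFinite G
  have := Fintype.ofFinite {χ : G → ℂ // IsIrreducibleCharacter χ}
  refine isInverseSemirational_iff.2 fun x m hm ↦ ?_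
  let f : G → ℂ := fun g ↦ if IsConj g x ∨ IsConj g x⁻¹ then 1 else 0
  have hf : ∀ a b, IsConj a b → f a = f b := fun a b hab ↦ by
    have : ∀ z, IsConj a z ↔ IsConj b z := fun z ↦ ⟨hab.symm.trans, hab.trans⟩
    simp only [f, this]
  have hinv : ∀ g, f g⁻¹ = f g := fun g ↦ by
    have h1 : ∀ a b : G, IsConj a⁻¹ b ↔ IsConj a b⁻¹ := fun a b ↦ by
      simp only [isConj_iff, ← conj_inv, inv_eq_iff_eq_inv]
    simp only [f, h1, inv_inv, or_comm]
  have hpow : ∀ (χ : {χ : G → ℂ // IsIrreducibleCharacter χ}) (g : G),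
      χ.1 (g ^ m) + χ.1 (g ^ m)⁻¹ = χ.1 g + χ.1 g⁻¹ := fun χ g ↦ by
    rw [← inv_pow]
    rcases h χ.1 χ.2 m hm with h1 | h1
    · rw [congrFun h1 g, congrFun h1 g⁻¹]
    · rw [congrFun h1 g, congrFun h1 g⁻¹, inv_inv, add_comm]
  -- As `f` is inversion-invariant, its expansion involves only χ(y) + χ(y⁻¹), which the power map
  -- preserves.
  have hexp : ∀ y, (Nat.card G : ℂ) * (f y + f y) =
      ∑ χ : {χ : G → ℂ // IsIrreducibleCharacter χ},
        (∑ g, f g * χ.1 g⁻¹) * (χ.1 y + χ.1 y⁻¹) := fun y ↦ by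
    nth_rw 2 [← hinv y]
    simp only [mul_add, Finset.sum_add_distrib, card_mul_eq_sum_irreducibleCharacter hf]
  have h1 := hexp (x ^ m)
  simp only [hpow] at h1
  rw [← hexp x] at h1
  have h2 := mul_left_cancel₀ (Nat.cast_ne_zero.2 Nat.card_pos.ne') h1
  have h3 : f x = 1 := if_pos (.inl (.refl x))
  by_contra h4
  have h5 : f (x ^ m) = 0 := if_neg h4
  rw [h3, h5] at h2
  norm_num at h2

theorem IsIrreducibleCharacter.finiteDimensional_fieldOfValues {χ : G → ℂ}
    (hχ : IsIrreducibleCharacter χ) : FiniteDimensional ℚ (fieldOfValues χ) :=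
  IntermediateField.finiteDimensional_adjoin (by rintro _ ⟨g, rfl⟩; exact hχ.isIntegral g)

/-- The element `χ g` of the field of values of `χ`. -/
def fieldOfValues.mk {G : Type u} (χ : G → ℂ) (g : G) : fieldOfValues χ :=
  ⟨χ g, IntermediateField.subset_adjoin ℚ _ ⟨g, rfl⟩⟩

/-- An embedding of the field of values is determined by its effect on the character. -/
theorem fieldOfValues.algHom_ext {G : Type u} {χ : G → ℂ} {φ ψ : fieldOfValues χ →ₐ[ℚ] ℂ}
    (h : ∀ g, φ (mk χ g) = ψ (mk χ g)) : φ = ψ :=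
  IntermediateField.algHom_ext_of_eq_adjoin _ rfl fun _ ⟨g, hg⟩ ↦ by
    subst hg; exact h g

theorem IsInverseSemirational.isQuadraticRational (h : IsInverseSemirational G) :
    IsQuadraticRational G := by
  classical
  intro χ hχ
  have := hχ.finiteDimensional_fieldOfValues
  have : NeZero (Nat.card G) := ⟨Nat.card_pos.ne'⟩
  let r : (fieldOfValues χ →ₐ[ℚ] ℂ) → G → ℂ := fun φ g ↦ φ (fieldOfValues.mk χ g)
  have hr : Function.Injective r := fun φ ψ hφψ ↦ fieldOfValues.algHom_ext (congrFun hφψ)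
  have hmem : ∀ φ, r φ ∈ ({χ, fun g ↦ χ g⁻¹} : Finset (G → ℂ)) := fun φ ↦ by
    obtain ⟨σ, hσ⟩ := exists_ringEquiv_complex_extending _ φ
    obtain ⟨m, hm, hσm⟩ := σ.exists_coprime_pow_of_complex (Nat.card G)
    have : r φ = fun g ↦ χ (g ^ m) := funext fun g ↦
      (hσ (fieldOfValues.mk χ g)).symm.trans (hχ.galois_apply hσm g)
    rw [this]
    simpa using h.comp_pow_eq hχ hm
  -- The degree is the number of embeddings into ℂ, each given by χ or its conjugate.
  have hcard : Fintype.card (fieldOfValues χ →ₐ[ℚ] ℂ) ≤ 2 :=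
    (Finset.card_le_card_of_injOn r (fun φ _ ↦ hmem φ) hr.injOn).trans Finset.card_le_two
  rw [AlgHom.card] at hcard
  rw [← finrank_eq_rank]
  exact_mod_cast hcard

theorem IsQuadraticRational.isInverseSemirational (hG : Odd (Nat.card G))
    (h : IsQuadraticRational G) : IsInverseSemirational G := by
  classical
  refine .of_comp_pow_eq fun χ hχ m hm ↦ ?_
  by_cases hreal : (fun g ↦ χ g⁻¹) = χ
  · refine .inl ((hχ.comp_pow hm).eq_of_real hG hχ (fun g ↦ ?_) (congrFun hreal))
    rw [inv_pow]
    exact congrFun hreal _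
  have := hχ.finiteDimensional_fieldOfValues
  have hrank : finrank ℚ (fieldOfValues χ) ≤ 2 := by
    have := h χ hχ
    rw [← finrank_eq_rank] at this
    exact_mod_cast this
  rw [← AlgHom.card ℚ (fieldOfValues χ) ℂ] at hrank
  have hext : ∀ k : ℕ, k.Coprime (Nat.card G) →
      ∃ φ : fieldOfValues χ →ₐ[ℚ] ℂ, ∀ g, φ (fieldOfValues.mk χ g) = χ (g ^ k) := fun k hk ↦ by
    obtain ⟨σ, hσ⟩ := hχ.exists_galois_eq_pow hk
    exact ⟨((σ : ℂ →+* ℂ).toRatAlgHom).comp (fieldOfValues χ).val, hσ⟩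
  -- Identity, conjugation and the m-th power map give three embeddings, so two coincide; the first
  -- two differ as χ is not real.
  obtain ⟨α, hα⟩ := hext 1 (Nat.coprime_one_left _)
  obtain ⟨β, hβ⟩ := hext _ coprime_card_sub_one
  obtain ⟨γ, hγ⟩ := hext m hm
  simp only [pow_one] at hα
  simp only [pow_card_sub_one] at hβ
  by_contra! hne
  have hαβ : α ≠ β := fun e ↦ hreal (funext fun g ↦ by rw [← hβ, ← e, hα])
  have hγα : α ≠ γ := fun e ↦ hne.1 (funext fun g ↦ by rw [← hγ, ← e, hα])
  have hγβ : β ≠ γ := fun e ↦ hne.2 (funext fun g ↦ by rw [← hγ, ← e, hβ])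
  exact absurd (Fintype.two_lt_card_iff.2 ⟨α, β, γ, hαβ, hγα, hγβ⟩) (not_lt.2 hrank)

end

theorem mainTheorem9 (G : Type u) [Group G] [Finite G] (hG : Odd (Nat.card G)) :
    List.TFAE [IsSemirational G, IsQuadraticRational G, IsInverseSemirational G] := by
  tfae_have 1 → 3 := IsSemirational.isInverseSemirational hG
  tfae_have 3 → 1 := IsInverseSemirational.isSemirational
  tfae_have 3 → 2 := IsInverseSemirational.isQuadraticRational
  tfae_have 2 → 3 := IsQuadraticRational.isInverseSemirational hG
  tfae_finish
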